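/- **Model.** In the CongestedClique with $n$ machines $0,1,\dots,n-1$, computation proceeds in synchronous rounds. In every round each machine performs unbounded local computation, possibly flipping private coins (coins of distinct machines are independent), and sends one message of $O(\log n)$ bits to every other machine. The vertices of the input graph $G$ are $0,1,\dots,n-1$, and machine $v$ represents the vertex $v$. **Chain.** Let $\mathcal A$ be a finite alphabet. A pairwise Markov random field on $G$ consists of vertex constraints $b_v:\mathcal A\to\mathbb R_{\ge0}$, none of them identically zero, and edge constraints $A_e:\mathcal A\times\mathcal A\to\mathbb R_{\ge0}$ for the edges $e=(u,v)$, $u<v$ (not necessarily symmetric); a labeling $l$ has weight $\prod_v b_v(l(v))\prod_{e=(u,v)}A_e(l(u),l(v))$. One transition of its distributed Metropolis–Hastings chain with activation probability $p\in[0,1]$ from the labeling $X$ is the following random step. 1. Independently, each vertex $v$ becomes active with probability $p$; an active $v$ draws a proposal $\sigma_v\in\mathcal A$ with probability proportional to $b_v$. 2. Independently, each edge $e=(u,v)$, $u<v$, is accepted with probability $$\frac{A_e(X_u,\sigma_v)}{\max A_e}\cdot\frac{A_e(\sigma_u,X_v)}{\max A_e}\cdot\frac{A_e(\sigma_u,\sigma_v)}{\max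 A_e},$$ where a fraction that is not well defined (because $\sigma_u$ or $\sigma_v$ does not exist, or $\max A_e=0$) equals $1$. 3. Each active vertex $v$ all of whose incident edges are accepted sets $X_v\gets\sigma_v$; all other labels are unchanged. **Theorem.** Consider $n$ instances $i=0,\dots,n-1$ of the distributed Metropolis–Hastings chain on the same graph $G$ and over the same alphabet $\mathcal A$. Instance $i$ has activation probability $p_i$, vertex constraints $b^{(i)}_v$ and edge constraints $A^{(i)}_e=F_i(\theta_e)$; so the instances may, for example, have different temperatures. Here each edge $e$ carries a parameter $\theta_e$ from a finite set $W$, and $|\mathcal A|$ and $|W|$ are bounded by a fixed polynomial in $n$. The numbers $p_i$ and the functions $F_i$, which assign to each parameter $w\in W$ a function $\mathcal A\times\mathcal A\to\mathbb R_{\ge0}$, are known to all machines. At the start machine $v$ knows only its incident edges $e$ with their parameters $\theta_e$, its vertex constraints $b^{(i)}_v$, and its current labels $X_{v,i}$, for all instances $i$. Then one transition of all $n$ instances can be simulated exactly in $O(n^{1/3})$ rounds. That is, there is a randomized CongestedClique algorithm, depending only on $n,\mathcal A,W,(p_i),(F_i)$, which runs for $O(n^{1/3})$ rounds with messages of $O(\log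 n)$ bits, and at whose end each machine $v$ holds a label $X'_{v,i}$ for each instance $i$ such that, for every graph $G$, all parameters $\theta$, all vertex constraints and all current labelings $X_{\cdot,i}$, the labelings $X'_{\cdot,0},\dots,X'_{\cdot,n-1}$ are independent and $X'_{\cdot,i}$ is distributed as one transition of instance $i$ from $X_{\cdot,i}$. The constants in both $O(\cdot)$ depend only on the polynomial that bounds $|\mathcal A|$ and $|W|$. Since every local Gibbs distribution is, by definition, represented by a pairwise Markov random field, this applies to its chain, whenever the edge constraints are of the above form; for example, to the Potts and hardcore models, and to any edge constraints known to all machines (let $\theta_e=e$). -/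

import Mathlib

open scoped NNReal ENNReal

noncomputable section

/-! ### Elementary probability -/

theorem tsum_prod_pmf_fin {α : Type} (n : ℕ) (p : Fin n → PMF α) :
    ∑' f : Fin n → α, ∏ i, p i (f i) = 1 := by
  induction n with
  | zero => simp
  | succ n ih =>
    rw [← (Fin.consEquiv fun _ : Fin (n + 1) => α).tsum_eq, ENNReal.tsum_prod']
    simp only [Fin.consEquiv, Equiv.coe_fn_mk, Fin.prod_univ_succ, Fin.cons_zero, Fin.cons_succ,
      ENNReal.tsum_mul_left]
    have h := ih fun i => p i.succ
    simp [h, (p 0).tsum_coe]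

theorem tsum_prod_pmf {ι α : Type} [Fintype ι] (p : ι → PMF α) :
    ∑' f : ι → α, ∏ i, p i (f i) = 1 := by
  have e := Fintype.equivFin ι
  rw [← tsum_prod_pmf_fin (Fintype.card ι) fun i => p (e.symm i),
    ← (Equiv.arrowCongr e (Equiv.refl α)).tsum_eq]
  refine tsum_congr fun f => ?_
  rw [← e.prod_comp]
  simp [Equiv.arrowCongr]

/-- The joint law of independent random variables with laws `p i`. -/
def PMF.product {ι α : Type} [Fintype ι] (p : ι → PMF α) : PMF (ι → α) :=
  ⟨fun f => ∏ i, p i (f i), ENNReal.summable.hasSum_iff.2 (tsum_prod_pmf p)⟩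

/-- A coin that shows `true` with probability `p`. -/
def coin (p : ℝ≥0) (hp : p ≤ 1) : PMF Bool :=
  PMF.ofFintype (fun b => if b then (p : ℝ≥0∞) else ((1 - p : ℝ≥0) : ℝ≥0∞)) (by
    simp only [Fintype.sum_bool, if_true, Bool.false_eq_true, if_false]
    exact_mod_cast add_tsub_cancel_of_le hp)

/-! ### The CongestedClique -/

/-- A randomized algorithm for the CongestedClique with machines `0, …, n - 1` and messages of
`bits` bits.  Machine `v` starts with a private input from `In` and ends with an output in `Out`.
Local computation is unbounded and may flip private coins: the new local state is drawn from a
distribution that depends on the machine's ID, its old state and the messages it has received. -/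
structure CliqueAlgorithm (n bits : ℕ) (In Out : Type) where
  /-- The local states of the machines. -/
  State : Type
  /-- Local computation before the first round. -/
  init : Fin n → In → PMF State
  /-- `send v s u` is the message that machine `v`, in state `s`, sends to machine `u`. -/
  send : Fin n → State → Fin n → BitVec bits
  /-- `recv v s m` is the law of the next state of machine `v` when its state is `s` and it
  receives the message `m u` from each machine `u`. -/
  recv : Fin n → State → (Fin n → BitVec bits) → PMF State
  /-- The number of communication rounds. -/
  rounds : ℕ
  /-- The output of a machine in its final state. -/
  output : Fin n → State → Out

namespace CliqueAlgorithm

variable {n bits : ℕ} {In Out : Type}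

/-- One synchronous round from the global state `s`; the coins of distinct machines are
independent. -/
def round (alg : CliqueAlgorithm n bits In Out) (s : Fin n → alg.State) :
    PMF (Fin n → alg.State) :=
  PMF.product fun v => alg.recv v (s v) fun u => alg.send u (s u) v

/-- The joint law of the outputs of all machines on the given inputs. -/
def run (alg : CliqueAlgorithm n bits In Out) (input : Fin n → In) : PMF (Fin n → Out) :=
  ((fun μ : PMF (Fin n → alg.State) => μ.bind alg.round)^[alg.rounds]
    (PMF.product fun v => alg.init v (input v))).map fun s v => alg.output v (s v)

end CliqueAlgorithm

/-! ### Pairwise Markov random fields and the distributed Metropolis–Hastings chain -/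

/-- A pairwise Markov random field on the graph `G` with alphabet `𝒜`.  The labeling `l` has
weight `∏ v, b v (l v) * ∏ e, A e (l e.inf) (l e.sup)`: the first argument of `A e` is the label of
the endpoint of `e` with smaller ID, the second one that of the endpoint with larger ID. -/
structure PairwiseMRF {n : ℕ} (G : SimpleGraph (Fin n)) (𝒜 : Type) where
  /-- The vertex constraints. -/
  b : Fin n → 𝒜 → ℝ≥0
  /-- The edge constraints; they need not be symmetric. -/
  A : G.edgeSet → 𝒜 → 𝒜 → ℝ≥0
  /-- No vertex constraint vanishes identically. -/
  exists_b_ne_zero : ∀ v, ∃ x, b v x ≠ 0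

/-- The fraction `a x y / max a`.  It is `1` where it is not well defined, i.e. if one of the two
labels is missing (`none`), or if `a` vanishes identically. -/
def acceptFactor {𝒜 : Type} [Fintype 𝒜] (a : 𝒜 → 𝒜 → ℝ≥0) : Option 𝒜 → Option 𝒜 → ℝ≥0
  | some x, some y =>
    if (Finset.univ.sup fun z : 𝒜 × 𝒜 => a z.1 z.2) = 0 then 1
    else a x y / Finset.univ.sup fun z : 𝒜 × 𝒜 => a z.1 z.2
  | _, _ => 1

theorem acceptFactor_le_one {𝒜 : Type} [Fintype 𝒜] (a : 𝒜 → 𝒜 → ℝ≥0) (x y : Option 𝒜) :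
    acceptFactor a x y ≤ 1 := by
  unfold acceptFactor
  split
  · rename_i x y
    split_ifs with h
    · exact le_rfl
    · exact div_le_one_of_le₀
        (Finset.le_sup (f := fun z : 𝒜 × 𝒜 => a z.1 z.2) (Finset.mem_univ (x, y))) zero_le
  · exact le_rfl

namespace PairwiseMRF

variable {n : ℕ} {G : SimpleGraph (Fin n)} {𝒜 : Type} [Fintype 𝒜]

/-- The distribution on labels proportional to `b v`. -/
def proposal (M : PairwiseMRF G 𝒜) (v : Fin n) : PMF 𝒜 :=
  PMF.normalize (fun x => (M.b v x : ℝ≥0∞))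
    (by
      obtain ⟨x, hx⟩ := M.exists_b_ne_zero v
      intro h
      exact hx (by simpa using ENNReal.tsum_eq_zero.1 h x))
    (by
      rw [tsum_fintype]
      exact ENNReal.sum_ne_top.2 fun x _ => ENNReal.coe_ne_top)

/-- A vertex is active with probability `p`; if active, it proposes a label drawn from
`M.proposal v`.  The value `none` stands for an inactive vertex. -/
def propose (M : PairwiseMRF G 𝒜) (p : ℝ≥0) (hp : p ≤ 1) (v : Fin n) : PMF (Option 𝒜) :=
  (coin p hp).bind fun active =>
    if active then (M.proposal v).map some else PMF.pure none

/-- The probability that the edge `e` is accepted, for current labels `X` and proposals `σ`. -/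
def acceptProb (M : PairwiseMRF G 𝒜) (X : Fin n → 𝒜) (σ : Fin n → Option 𝒜) (e : G.edgeSet) :
    ℝ≥0 :=
  acceptFactor (M.A e) (some (X e.1.inf)) (σ e.1.sup) *
    acceptFactor (M.A e) (σ e.1.inf) (some (X e.1.sup)) *
    acceptFactor (M.A e) (σ e.1.inf) (σ e.1.sup)

theorem acceptProb_le_one (M : PairwiseMRF G 𝒜) (X : Fin n → 𝒜) (σ : Fin n → Option 𝒜)
    (e : G.edgeSet) : M.acceptProb X σ e ≤ 1 :=
  mul_le_one' (mul_le_one' (acceptFactor_le_one _ _ _) (acceptFactor_le_one _ _ _))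
    (acceptFactor_le_one _ _ _)

open Classical in
/-- The new labels: an active vertex takes its proposal iff all incident edges are accepted. -/
def update (X : Fin n → 𝒜) (σ : Fin n → Option 𝒜) (accepted : G.edgeSet → Bool) (v : Fin n) : 𝒜 :=
  if ∀ e : G.edgeSet, v ∈ e.1 → accepted e = true then (σ v).getD (X v) else X v

open Classical in
/-- One transition of the distributed Metropolis–Hastings chain with activation probability `p`
from the labeling `X`. -/
def transition (M : PairwiseMRF G 𝒜) (p : ℝ≥0) (hp : p ≤ 1) (X : Fin n → 𝒜) :
    PMF (Fin n → 𝒜) :=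
  (PMF.product fun v => M.propose p hp v).bind fun σ =>
    (PMF.product fun e : G.edgeSet => coin (M.acceptProb X σ e) (M.acceptProb_le_one X σ e)).map
      fun accepted => update X σ accepted

end PairwiseMRF

/-- What the machine of a vertex knows about `n` instances of the chain at the start: its incident
edges with their parameters, its vertex constraint in each instance, and its current label in each
instance. -/
structure VertexInput (n : ℕ) (𝒜 W : Type) where
  /-- The parameter of the edge to each neighbour, and `none` for the other vertices. -/
  edge : Fin n → Option W
  /-- The vertex constraint in each instance. -/
  constraint : Fin n → 𝒜 → ℝ≥0
  /-- The current label in each instance. -/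
  label : Fin n → 𝒜

open Classical in
/-- The input of the machine of `v`, where `θ` holds the edge parameters, `M i` is the Markov random
field of instance `i`, and `X i` is its current labeling. -/
def vertexInput {n : ℕ} {𝒜 W : Type} (G : SimpleGraph (Fin n)) (θ : G.edgeSet → W)
    (M : Fin n → PairwiseMRF G 𝒜) (X : Fin n → Fin n → 𝒜) (v : Fin n) : VertexInput n 𝒜 W where
  edge u := if h : G.Adj v u then some (θ ⟨s(v, u), h⟩) else none
  constraint i := (M i).b v
  label i := X i v

end

noncomputable section

/-! ### Independent random variables -/

/-! The difficulty is volume: deciding every edge in every instance takes up to order n³ coins,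
while the edge parameters alone fill the bandwidth of a round. Cut the indices `0, …, n - 1`, which
name vertices as well as instances, into k = ⌊n^(1/3)⌋ blocks of at most s = 8k² members. Since k³ ≤
n, each triple of blocks gets a machine of its own, which flips the coins of all edges from the
first block to the second in all instances of the third. It needs s² edge parameters and 2s² pairs
of a label and a proposal. A parameter serves all instances of the block, because `F` is known
everywhere; this is why the edge constraints have the form F_i(θ_e). Each vertex ships its data in
3nk messages, and one-bit verdicts return along the same routes. As s² = 64k⁴ ≤ 64nk, every machine
sends and receives O(nk) messages (`card_owner_le`, `card_worker_le`).

The pattern of messages does not depend on the graph, since non-edges are reported too. Hence a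
routing schedule can be fixed in advance: a greedy colouring assigns to each message a relay and a
time step such that messages with a common sender or a common receiver never collide
(`exists_color_injOn_fibers`). This delivers O(nk) messages per machine in O(k) rounds
(`exists_cliqueAlgorithm`).

The simulation is exact because each vertex draws its own proposals, and each edge in each instance
is decided by the coin of exactly one machine, with the correct probability. Unused coins are
discarded by taking a marginal (`product_product_marginal`, `chainAlgorithm_run_eq`). -/

theorem ENNReal.prod_tsum_fin {α : Type} (n : ℕ) (F : Fin n → α → ℝ≥0∞) :
    ∏ i, ∑' a, F i a = ∑' f : Fin n → α, ∏ i, F i (f i) := by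
  induction n with
  | zero => simp
  | succ n ih =>
    rw [← (Fin.consEquiv fun _ : Fin (n + 1) => α).tsum_eq, ENNReal.tsum_prod']
    simp only [Fin.consEquiv, Equiv.coe_fn_mk, Fin.prod_univ_succ, Fin.cons_zero, Fin.cons_succ,
      ENNReal.tsum_mul_left, ENNReal.tsum_mul_right, ih]

theorem ENNReal.prod_tsum {ι α : Type} [Fintype ι] (F : ι → α → ℝ≥0∞) :
    ∏ i, ∑' a, F i a = ∑' f : ι → α, ∏ i, F i (f i) := by
  have e := Fintype.equivFin ι
  rw [← e.symm.prod_comp, ENNReal.prod_tsum_fin,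
    ← (Equiv.arrowCongr e (Equiv.refl α)).tsum_eq]
  refine tsum_congr fun f => ?_
  rw [← e.prod_comp]
  simp [Equiv.arrowCongr]

namespace PMF

variable {ι κ α β γ : Type} [Fintype ι] [Fintype κ]

theorem product_apply (p : ι → PMF α) (f : ι → α) : product p f = ∏ i, p i (f i) := rfl

/-- Two-stage independent experiments can be run stage by stage. This is the distributive law
`ENNReal.prod_tsum`, which needs no summability in `ℝ≥0∞`. -/
theorem product_bind (p : ι → PMF α) (q : ι → α → PMF β) :
    (product fun i => (p i).bind (q i)) =
      (product p).bind fun f => product fun i => q i (f i) := by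
  ext g
  simp only [product_apply, PMF.bind_apply, ENNReal.prod_tsum, Finset.prod_mul_distrib]

theorem product_pure (f : ι → α) : (product fun i => PMF.pure (f i)) = PMF.pure f := by
  classical
  ext g
  simp only [product_apply, PMF.pure_apply, Finset.prod_ite_zero, Finset.prod_const_one]
  simp [funext_iff]

theorem product_map (p : ι → PMF α) (q : ι → α → β) :
    (product fun i => (p i).map (q i)) = (product p).map fun f i => q i (f i) := by
  simp only [← PMF.bind_pure_comp, Function.comp_def, product_bind, product_pure]

theorem product_marginal (p : ι → PMF α) (g : κ → ι) (hg : Function.Injective g) :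
    ((product p).map fun f k => f (g k)) = product fun k => p (g k) := by
  classical
  ext y
  -- The indicator is spread over the fibres of `g`, so that the sum over `f` factorizes over `ι`.
  -- Indices outside the range of `g` then contribute total mass 1, and the others a single value,
  -- their fibres being singletons.
  have key : ∀ f : ι → α, (if y = fun k => f (g k) then product p f else 0) =
      ∏ i, p i (f i) * ∏ k with g k = i, if y k = f i then 1 else 0 := by
    intro f
    rw [Finset.prod_mul_distrib, product_apply]
    have h : ∏ i, ∏ k with g k = i, (if y k = f i then (1 : ℝ≥0∞) else 0) =
        ∏ k, if y k = f (g k) then 1 else 0 := by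
      rw [← Finset.prod_fiberwise Finset.univ g]
      refine Finset.prod_congr rfl fun i _ => Finset.prod_congr rfl fun k hk => ?_
      rw [(Finset.mem_filter.1 hk).2]
    rw [h, Finset.prod_ite_zero, Finset.prod_const_one]
    simp [funext_iff]
  rw [PMF.map_apply, product_apply]
  refine (tsum_congr fun f => Eq.trans (by congr) (key f)).trans ?_
  rw [← ENNReal.prod_tsum fun i a => p i a * ∏ k with g k = i, if y k = a then 1 else 0]
  symm
  refine Fintype.prod_of_injective g hg _ _ (fun i hi => ?_) (fun k => ?_)
  · have : (Finset.univ.filter fun k => g k = i) = ∅ := by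
      ext k
      simpa using fun h => hi ⟨k, h⟩
    simp [this, (p i).tsum_coe]
  · have : (Finset.univ.filter fun k' => g k' = g k) = {k} := by
      ext k'
      simpa using hg.eq_iff
    simp only [this, Finset.prod_singleton]
    rw [tsum_eq_single (y k)]
    · simp
    · intro a ha
      simp [ha.symm]

theorem product_product (p : ι → κ → PMF α) :
    (product fun i => product fun k => p i k) =
      (product fun x : ι × κ => p x.1 x.2).map fun f i k => f (i, k) := by
  classical
  ext y
  rw [PMF.map_apply, tsum_eq_single fun x => y x.1 x.2]
  · simp [product_apply, Fintype.prod_prod_type]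
  · intro f hf
    rw [if_neg]
    rintro rfl
    exact hf rfl

theorem product_swap (p : ι → κ → PMF α) :
    (product fun k => product fun i => p i k) =
      (product fun i => product fun k => p i k).map fun f k i => f i k := by
  have h : (product fun x : κ × ι => p x.2 x.1) =
      (product fun x : ι × κ => p x.1 x.2).map fun f x => f x.swap :=
    (product_marginal (fun x : ι × κ => p x.1 x.2) (Prod.swap : κ × ι → ι × κ)
      Prod.swap_injective).symm
  rw [product_product, product_product, h, PMF.map_comp, PMF.map_comp]
  rfl

/-- This serves to keep, out of all coins of all machines, one coin for each edge and instance. -/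
theorem product_product_marginal (p : ι → κ → PMF α) {ν : Type} [Fintype ν] (g : ν → ι)
    (h : ν → κ) (hgh : Function.Injective fun x => (g x, h x)) :
    ((product fun i => product fun k => p i k).map fun f x => f (g x) (h x)) =
      product fun x => p (g x) (h x) := by
  rw [product_product, PMF.map_comp, ← product_marginal (fun x : ι × κ => p x.1 x.2) _ hgh]
  rfl

theorem iterate_bind (μ : PMF α) (q : α → PMF α) (k : ℕ) :
    (fun ν : PMF α => ν.bind q)^[k] μ =
      μ.bind fun a => (fun ν : PMF α => ν.bind q)^[k] (PMF.pure a) := by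
  induction k with
  | zero => simp
  | succ k ih =>
    simp only [Function.iterate_succ_apply']
    rw [ih, PMF.bind_bind]

/-- If `τ` steps of `q'` from `e a` do what one step of `q` from `a` does, then `τ * k` steps of
`q'` do what `k` steps of `q` do. -/
theorem iterate_bind_map (q : α → PMF α) (q' : β → PMF β) (e : α → β) (τ : ℕ)
    (h : ∀ a, (fun ν : PMF β => ν.bind q')^[τ] (PMF.pure (e a)) = (q a).map e)
    (k : ℕ) (μ : PMF α) :
    (fun ν : PMF β => ν.bind q')^[τ * k] (μ.map e) =
      ((fun ν : PMF α => ν.bind q)^[k] μ).map e := by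
  induction k with
  | zero => simp
  | succ k ih =>
    rw [Nat.mul_succ, add_comm, Function.iterate_add_apply, ih, Function.iterate_succ_apply',
      iterate_bind, PMF.bind_map, PMF.map_bind]
    simp only [Function.comp_def, h]

end PMF

/-! ### Routing -/

/-- Greedy colouring: if every fibre of `f` and of `g` has at most `d` elements, then `2 * d`
colours suffice to give distinct colours to elements of the same fibre of `f` or of `g`. -/
theorem exists_color_injOn_fibers {M V C : Type} [Fintype M] [Fintype C] [DecidableEq V]
    (f g : M → V) (d : ℕ)
    (hf : ∀ v, (Finset.univ.filter fun m => f m = v).card ≤ d)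
    (hg : ∀ v, (Finset.univ.filter fun m => g m = v).card ≤ d)
    (hC : 2 * d ≤ Fintype.card C) :
    ∃ color : M → C, (∀ m m', f m = f m' → color m = color m' → m = m') ∧
      ∀ m m', g m = g m' → color m = color m' → m = m' := by
  classical
  rcases isEmpty_or_nonempty M with hM | ⟨⟨m₀⟩⟩
  · exact ⟨hM.elim, fun m => hM.elim m, fun m => hM.elim m⟩
  have hd : 0 < d := (Finset.card_pos.2 ⟨m₀, by simp⟩).trans_le (hf (f m₀))
  have c₀ : C := (Fintype.card_pos_iff.1 (by omega)).some
  suffices h : ∀ s : Finset M, ∃ color : M → C, ∀ m ∈ s, ∀ m' ∈ s,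
      (f m = f m' ∨ g m = g m') → color m = color m' → m = m' by
    obtain ⟨color, h⟩ := h Finset.univ
    exact ⟨color, fun m m' e => h m (by simp) m' (by simp) (.inl e),
      fun m m' e => h m (by simp) m' (by simp) (.inr e)⟩
  intro s
  induction s using Finset.induction_on with
  | empty => exact ⟨fun _ => c₀, by simp⟩
  | insert a s ha ih =>
    obtain ⟨color, hcol⟩ := ih
    -- The bound is strict because `a` itself lies in its fibre but not in `s`. So the two fibres
    -- through `a` forbid fewer than `2 * d` colours.
    have fiber : ∀ F : M → V, (∀ v, (Finset.univ.filter fun m => F m = v).card ≤ d) →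
        (s.filter fun m => F m = F a).card < d := fun F hF =>
      (Finset.card_lt_card (Finset.ssubset_iff_of_subset
        (Finset.filter_subset_filter _ (Finset.subset_univ s)) |>.2
          ⟨a, by simp, by simp [ha]⟩)).trans_le (hF (F a))
    obtain ⟨c, hc⟩ : ∃ c, c ∉ ((s.filter fun m => f m = f a) ∪
        s.filter fun m => g m = g a).image color := by
      by_contra! h
      have h1 := Finset.card_le_card (fun c (_ : c ∈ Finset.univ) => h c)
      have h2 := Finset.card_image_le (s := (s.filter fun m => f m = f a) ∪
        s.filter fun m => g m = g a) (f := color)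
      have h3 := Finset.card_union_le (s.filter fun m => f m = f a) (s.filter fun m => g m = g a)
      have h4 := fiber f hf
      have h5 := fiber g hg
      rw [Finset.card_univ] at h1
      omega
    have hc' : ∀ m ∈ s, (f m = f a ∨ g m = g a) → color m ≠ c := by
      intro m hm hfg e
      refine hc (Finset.mem_image.2 ⟨m, ?_, e⟩)
      simpa [hm] using hfg
    have hne : ∀ m ∈ s, m ≠ a := fun m hm e => ha (e ▸ hm)
    refine ⟨Function.update color a c, fun m hm m' hm' hfg e => ?_⟩
    rcases Finset.mem_insert.1 hm with rfl | hs <;> rcases Finset.mem_insert.1 hm' with rfl | hs'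
    · rfl
    · rw [Function.update_self, Function.update_of_ne (hne _ hs')] at e
      exact (hc' m' hs' (hfg.imp Eq.symm Eq.symm) e.symm).elim
    · rw [Function.update_self, Function.update_of_ne (hne _ hs)] at e
      exact (hc' m hs hfg e).elim
    · rw [Function.update_of_ne (hne _ hs), Function.update_of_ne (hne _ hs')] at e
      exact hcol m hs m' hs' hfg e

/-- A randomized algorithm that communicates through a fixed set `M` of messages with contents in
`B`: in every round, each message `m` is sent by the machine `src m` to the machine `dst m`. -/
structure RoutedAlgorithm (n : ℕ) (M B In Out : Type) where
  /-- The sender of a message. -/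
  src : M → Fin n
  /-- The receiver of a message. -/
  dst : M → Fin n
  /-- The local states of the machines. -/
  State : Type
  /-- Local computation before the first round. -/
  init : Fin n → In → PMF State
  /-- The content of each message sent by a machine. -/
  send : Fin n → State → M → B
  /-- The law of the next state, given the contents of the messages received. -/
  recv : Fin n → State → (M → B) → PMF State
  /-- The number of rounds. -/
  rounds : ℕ
  /-- The output of a machine in its final state. -/
  output : Fin n → State → Out

/-! ### Simulation of routed algorithms by relays -/

namespace RoutedAlgorithm

variable {n bits : ℕ} {M B In Out : Type}

variable (alg : RoutedAlgorithm n M B In Out) (enc : B → BitVec bits) (T : ℕ)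
  (color : M → Fin n × Fin T)

open Classical in
/-- The message that `u` sends to `v` in step `t` of the simulation of a round.  In the first `T`
steps each message travels from its sender to the relay given by its colour, in the last `T` steps
from there to its receiver.  Here `s` is the state of `u`, and `h t w` is what `u` has received
from `w` in step `t`. -/
def relaySend (u : Fin n) (s : alg.State) (t : ℕ) (h : ℕ → Fin n → BitVec bits) (v : Fin n) :
    BitVec bits :=
  if t < T then
    if H : ∃ m, alg.src m = u ∧ (color m).1 = v ∧ ((color m).2 : ℕ) = t then
      enc (alg.send u s H.choose) else 0
  else
    if H : ∃ m, alg.dst m = v ∧ (color m).1 = u ∧ ((color m).2 : ℕ) + T = t then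
      h (t - T) (alg.src H.choose) else 0

open Classical in
/-- The message that `u` sends to `v` in step `t` of the simulation of a round from the global
state `s`. -/
def transcript (s : Fin n → alg.State) (t : ℕ) (u v : Fin n) : BitVec bits :=
  if t < T then
    if H : ∃ m, alg.src m = u ∧ (color m).1 = v ∧ ((color m).2 : ℕ) = t then
      enc (alg.send u (s u) H.choose) else 0
  else
    if H : ∃ m, alg.dst m = v ∧ (color m).1 = u ∧ ((color m).2 : ℕ) + T = t then
      enc (alg.send (alg.src H.choose) (s (alg.src H.choose)) H.choose) else 0

/-- What `v` has received before step `j`. -/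
def history (s : Fin n → alg.State) (j : ℕ) (v : Fin n) (t : ℕ) (u : Fin n) : BitVec bits :=
  if t < j then alg.transcript enc T color s t u v else 0

variable {alg enc T color}

/-- Among the messages of one sender the colour determines the message, so the choice in
`transcript` can only return `m`. In `transcript_dst` the same holds for one receiver. -/
theorem transcript_src (hsrc : ∀ m m', alg.src m = alg.src m' → color m = color m' → m = m')
    (s : Fin n → alg.State) (m : M) :
    alg.transcript enc T color s (color m).2 (alg.src m) (color m).1 =
      enc (alg.send (alg.src m) (s (alg.src m)) m) := by
  have H : ∃ m', alg.src m' = alg.src m ∧ (color m').1 = (color m).1 ∧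
      ((color m').2 : ℕ) = (color m).2 := ⟨m, rfl, rfl, rfl⟩
  have e : H.choose = m :=
    hsrc _ _ H.choose_spec.1 (Prod.ext H.choose_spec.2.1 (Fin.ext H.choose_spec.2.2))
  rw [transcript, if_pos (color m).2.isLt, dif_pos H, e]

theorem transcript_dst (hdst : ∀ m m', alg.dst m = alg.dst m' → color m = color m' → m = m')
    (s : Fin n → alg.State) (m : M) :
    alg.transcript enc T color s ((color m).2 + T) (color m).1 (alg.dst m) =
      enc (alg.send (alg.src m) (s (alg.src m)) m) := by
  have H : ∃ m', alg.dst m' = alg.dst m ∧ (color m').1 = (color m).1 ∧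
      ((color m').2 : ℕ) + T = (color m).2 + T := ⟨m, rfl, rfl, rfl⟩
  have e : H.choose = m :=
    hdst _ _ H.choose_spec.1
      (Prod.ext H.choose_spec.2.1 (Fin.ext (Nat.add_right_cancel H.choose_spec.2.2)))
  rw [transcript, if_neg (by omega), dif_pos H, e]

/-- `relaySend` uses only what the relay knows, whereas `transcript` refers to the global state.
They agree because a relay forwards in step `t` what reached it in step `t - T`, and that was the
right content by `transcript_src`. -/
theorem relaySend_history
    (hsrc : ∀ m m', alg.src m = alg.src m' → color m = color m' → m = m')
    (s : Fin n → alg.State) (t : ℕ) (u v : Fin n) :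
    alg.relaySend enc T color u (s u) t (alg.history enc T color s t u) v =
      alg.transcript enc T color s t u v := by
  unfold relaySend
  split_ifs with h H H
  · rw [transcript, if_pos h, dif_pos H]
  · rw [transcript, if_pos h, dif_neg H]
  · rw [transcript, if_neg h, dif_pos H]
    obtain ⟨-, h2, h3⟩ := H.choose_spec
    have := transcript_src (enc := enc) hsrc s H.choose
    rw [h2] at this
    rw [history, if_pos (by have := (color H.choose).2.isLt; omega), ← this]
    congr 1
    omega
  · rw [transcript, if_neg h, dif_neg H]

theorem update_history (s : Fin n → alg.State) (j : ℕ) (v : Fin n) :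
    Function.update (alg.history enc T color s j v) j
      (fun u => alg.transcript enc T color s j u v) = alg.history enc T color s (j + 1) v := by
  funext t u
  rcases eq_or_ne t j with rfl | h
  · simp [history]
  · have : t < j ↔ t < j + 1 := by omega
    simp [history, Function.update_of_ne h, this]

variable [Inhabited B]

/-- The contents of the messages received by `v`. -/
def received (alg : RoutedAlgorithm n M B In Out) (s : Fin n → alg.State) (v : Fin n) (m : M) : B :=
  if alg.dst m = v then alg.send (alg.src m) (s (alg.src m)) m else default

/-- One round from the global state `s`. -/
def round (alg : RoutedAlgorithm n M B In Out) (s : Fin n → alg.State) :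
    PMF (Fin n → alg.State) :=
  PMF.product fun v => alg.recv v (s v) (alg.received s v)

/-- The joint law of the outputs of all machines on the given inputs. -/
def run (alg : RoutedAlgorithm n M B In Out) (input : Fin n → In) : PMF (Fin n → Out) :=
  ((fun μ : PMF (Fin n → alg.State) => μ.bind alg.round)^[alg.rounds]
    (PMF.product fun v => alg.init v (input v))).map fun s v => alg.output v (s v)

variable (alg enc T color)

/-- The messages that `v` reads off the history of `2 * T` steps. -/
def relayRead (v : Fin n) (h : ℕ → Fin n → BitVec bits) (m : M) : B :=
  open Classical in
  if alg.dst m = v then Function.invFun enc (h ((color m).2 + T) (color m).1) else default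

/-- The simulation of a routed algorithm by relays: `2 * T` rounds for each round. -/
abbrev relayed : CliqueAlgorithm n bits In Out where
  State := alg.State × ℕ × (ℕ → Fin n → BitVec bits)
  init v x := (alg.init v x).map fun s => (s, 0, 0)
  send u s v := alg.relaySend enc T color u s.1 s.2.1 s.2.2 v
  recv v s m :=
    if s.2.1 + 1 = 2 * T then
      (alg.recv v s.1 (alg.relayRead enc T color v (Function.update s.2.2 s.2.1 m))).map
        fun s' => (s', 0, 0)
    else PMF.pure (s.1, s.2.1 + 1, Function.update s.2.2 s.2.1 m)
  rounds := 2 * T * alg.rounds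
  output v s := alg.output v s.1

variable {alg enc T color}

/-- Before the last of the `2 * T` steps nothing random happens: the states stay frozen while the
histories fill up. -/
theorem relayed_iterate (hsrc : ∀ m m', alg.src m = alg.src m' → color m = color m' → m = m')
    (s : Fin n → alg.State) (j : ℕ) (hj : j < 2 * T) :
    (fun μ : PMF (Fin n → (alg.relayed enc T color).State) =>
      μ.bind (alg.relayed enc T color).round)^[j] (PMF.pure fun v => (s v, 0, 0)) =
    PMF.pure fun v => (s v, j, alg.history enc T color s j v) := by
  induction j with
  | zero =>
    simp only [Function.iterate_zero, id]
    congr 1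
  | succ j ih =>
    rw [Function.iterate_succ_apply', ih (by omega), PMF.pure_bind, ← PMF.product_pure]
    unfold CliqueAlgorithm.round
    congr 1
    funext v
    simp only [relayed]
    rw [if_neg (by omega)]
    simp only [relaySend_history hsrc, update_history]

theorem relayed_round (henc : Function.Injective enc) (hT : 0 < T)
    (hsrc : ∀ m m', alg.src m = alg.src m' → color m = color m' → m = m')
    (hdst : ∀ m m', alg.dst m = alg.dst m' → color m = color m' → m = m')
    (s : Fin n → alg.State) :
    (fun μ : PMF (Fin n → (alg.relayed enc T color).State) =>
      μ.bind (alg.relayed enc T color).round)^[2 * T] (PMF.pure fun v => (s v, 0, 0)) =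
    (alg.round s).map fun s' v => (s' v, 0, 0) := by
  obtain ⟨j, hj⟩ : ∃ j, 2 * T = j + 1 := ⟨2 * T - 1, by omega⟩
  rw [hj, Function.iterate_succ_apply', relayed_iterate hsrc s j (by omega), PMF.pure_bind]
  unfold CliqueAlgorithm.round round
  refine Eq.trans ?_ (PMF.product_map _ fun _ s' => (s', 0, 0))
  congr 1
  funext v
  simp only [relayed]
  rw [if_pos hj.symm]
  simp only [relaySend_history hsrc, update_history]
  congr 2
  funext m
  unfold relayRead received
  split_ifs with h
  · subst h
    rw [history, if_pos (by omega), transcript_dst hdst, Function.leftInverse_invFun henc]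
  · rfl

theorem relayed_run (henc : Function.Injective enc) (hT : 0 < T)
    (hsrc : ∀ m m', alg.src m = alg.src m' → color m = color m' → m = m')
    (hdst : ∀ m m', alg.dst m = alg.dst m' → color m = color m' → m = m')
    (input : Fin n → In) : (alg.relayed enc T color).run input = alg.run input := by
  have h := PMF.iterate_bind_map alg.round (alg.relayed enc T color).round
    (fun s v => (s v, 0, 0)) (2 * T) (relayed_round henc hT hsrc hdst) alg.rounds
    (PMF.product fun v => alg.init v (input v))
  have hinit : (PMF.product fun v => (alg.relayed enc T color).init v (input v)) =
      (PMF.product fun v => alg.init v (input v)).map fun s v => (s v, 0, 0) :=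
    PMF.product_map _ _
  rw [CliqueAlgorithm.run, hinit, run]
  refine (congrArg (PMF.map _) h).trans ?_
  rw [PMF.map_comp]
  rfl

/-- A routed algorithm in which every machine sends and receives at most `d` messages per round,
`2 * d ≤ n * T`, takes `2 * T` rounds of the CongestedClique for each of its rounds. -/
theorem exists_cliqueAlgorithm [Fintype M] [Fintype B] (alg : RoutedAlgorithm n M B In Out)
    (d T : ℕ) (hT : 0 < T) (hd : 2 * d ≤ n * T) (hB : Fintype.card B ≤ 2 ^ bits)
    (hsrc : ∀ v, (Finset.univ.filter fun m => alg.src m = v).card ≤ d)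
    (hdst : ∀ v, (Finset.univ.filter fun m => alg.dst m = v).card ≤ d) :
    ∃ alg' : CliqueAlgorithm n bits In Out, alg'.rounds = 2 * T * alg.rounds ∧
      ∀ input, alg'.run input = alg.run input := by
  obtain ⟨color, h1, h2⟩ := exists_color_injOn_fibers (C := Fin n × Fin T) alg.src alg.dst d
    hsrc hdst (by simpa using hd)
  have henc : Nonempty (B ↪ Fin (2 ^ bits)) := Function.Embedding.nonempty_of_card_le (by simpa)
  obtain ⟨enc⟩ := henc
  exact ⟨alg.relayed (fun b => BitVec.ofFin (enc b)) T color, rfl,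
    relayed_run (fun a b h => enc.injective (by simpa using h)) hT h1 h2⟩

end RoutedAlgorithm

/-! ### The joint law of the transitions -/

namespace PairwiseMRF

variable {n : ℕ} {G : SimpleGraph (Fin n)} {𝒜 W : Type} [Fintype 𝒜]

open Classical in
/-- The joint law of one transition of each instance: first all vertices draw their proposals in
all instances, then all edges draw their coins. -/
theorem product_transition (M : Fin n → PairwiseMRF G 𝒜) (p : Fin n → ℝ≥0) (hp : ∀ i, p i ≤ 1)
    (X : Fin n → Fin n → 𝒜) :
    (PMF.product fun i => (M i).transition (p i) (hp i) (X i)).map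
        (fun (Y : Fin n → Fin n → 𝒜) (v i : Fin n) => Y i v) =
      (PMF.product fun v => PMF.product fun i => (M i).propose (p i) (hp i) v).bind fun σ =>
        (PMF.product fun x : Fin n × G.edgeSet =>
          coin ((M x.1).acceptProb (X x.1) (fun u => σ u x.1) x.2)
            ((M x.1).acceptProb_le_one (X x.1) (fun u => σ u x.1) x.2)).map
          fun acc v i => update (X i) (fun u => σ u i) (fun e => acc (i, e)) v := by
  simp only [transition]
  rw [PMF.product_bind, PMF.map_bind, PMF.product_swap, PMF.bind_map]
  congr 1
  funext σ
  rw [Function.comp_apply, PMF.product_map, PMF.product_product, PMF.map_comp, PMF.map_comp]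
  rfl

end PairwiseMRF

namespace VertexInput

variable {n : ℕ} {𝒜 W : Type} [Fintype 𝒜]

open Classical in
/-- The proposal of an active vertex in instance `i`, computed from its input. -/
def proposal (x : VertexInput n 𝒜 W) (i : Fin n) : PMF (Option 𝒜) :=
  if h : ∃ a, x.constraint i a ≠ 0 then
    (PMF.normalize (fun a => (x.constraint i a : ℝ≥0∞))
      (by
        obtain ⟨a, ha⟩ := h
        intro h'
        exact ha (by simpa using ENNReal.tsum_eq_zero.1 h' a))
      (by
        rw [tsum_fintype]
        exact ENNReal.sum_ne_top.2 fun x _ => ENNReal.coe_ne_top)).map some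
  -- This junk value never arises from a Markov random field, by `exists_b_ne_zero`.
  else PMF.pure none

/-- The proposals of a vertex in all instances, computed from its input. -/
def propose (x : VertexInput n 𝒜 W) (p : Fin n → ℝ≥0) (hp : ∀ i, p i ≤ 1) :
    PMF (Fin n → Option 𝒜) :=
  PMF.product fun i => (coin (p i) (hp i)).bind fun active =>
    if active then x.proposal i else PMF.pure none

theorem propose_vertexInput (p : Fin n → ℝ≥0) (hp : ∀ i, p i ≤ 1) (G : SimpleGraph (Fin n))
    (θ : G.edgeSet → W) (M : Fin n → PairwiseMRF G 𝒜) (X : Fin n → Fin n → 𝒜) (v : Fin n) :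
    (vertexInput G θ M X v).propose p hp =
      PMF.product fun i => (M i).propose (p i) (hp i) v := by
  have h : ∀ i, (vertexInput G θ M X v).proposal i = ((M i).proposal v).map some := fun i => by
    exact dif_pos ((M i).exists_b_ne_zero v)
  simp only [propose, h]
  rfl

end VertexInput

/-! ### The simulation of the chains -/

/-- The roles of a message: the parameter of an edge, or data on its lower or its upper
endpoint. -/
inductive Role
  | edge
  | lower
  | upper
  deriving DecidableEq

instance : Fintype Role :=
  ⟨{.edge, .lower, .upper}, by rintro (_ | _ | _) <;> simp⟩

theorem Role.card : Fintype.card Role = 3 := rfl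

/-- A division of the machines into `k` blocks of at most `s` members, and a machine for each
triple of blocks. -/
structure CubePartition (n k s : ℕ) where
  /-- The block of a machine and its position there. -/
  index : Fin n ↪ Fin k × Fin s
  /-- The machine in charge of a triple of blocks. -/
  machine : Fin k × Fin k × Fin k ↪ Fin n

namespace CubePartition

variable {n k s : ℕ} (C : CubePartition n k s)

/-- The block of a machine. -/
def block (v : Fin n) : Fin k := (C.index v).1

/-- The machine in charge of the edge between `t.1` and `t.2.1` in instance `t.2.2`. -/
def inCharge (t : Fin n × Fin n × Fin n) : Fin n :=
  C.machine (C.block t.1, C.block t.2.1, C.block t.2.2)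

/-- A message is exchanged between its owner and its worker. -/
def owner (m : Role × Fin n × Fin n × Fin k) : Fin n := m.2.1

/-- The worker of a message: a machine in charge of the objects that the message is about. -/
def worker : Role × Fin n × Fin n × Fin k → Fin n
  | (.edge, u, v, z) => C.machine (C.block u, C.block v, z)
  | (.lower, u, i, z) => C.machine (C.block u, z, C.block i)
  | (.upper, v, i, z) => C.machine (z, C.block v, C.block i)

theorem card_owner_le (v : Fin n) :
    (Finset.univ.filter fun m : Role × Fin n × Fin n × Fin k => owner m = v).card ≤
      3 * (n * k) := by
  refine (Finset.card_le_card_of_injOn (t := (Finset.univ : Finset (Role × Fin n × Fin k)))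
    (fun m => (m.1, m.2.2)) (fun _ _ => by simp) ?_).trans (by simp [Role.card])
  rintro ⟨r, x, y⟩ h ⟨r', x', y'⟩ h' e
  replace h := (Finset.mem_filter.1 (Finset.mem_coe.1 h)).2
  replace h' := (Finset.mem_filter.1 (Finset.mem_coe.1 h')).2
  simp only [Prod.mk.injEq] at e ⊢
  exact ⟨e.1, h.trans h'.symm, e.2⟩

/-- As `machine` is injective, the role and the worker reveal the third block index `z` and the
blocks of both objects of the message. Only the two positions inside these blocks remain free. -/
theorem card_worker_le (w : Fin n) :
    (Finset.univ.filter fun m => C.worker m = w).card ≤ 3 * (s * s) := by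
  refine (Finset.card_le_card_of_injOn (t := (Finset.univ : Finset (Role × Fin s × Fin s)))
    (fun m => (m.1, (C.index m.2.1).2, (C.index m.2.2.1).2)) (fun _ _ => by simp) ?_).trans
      (by simp [Role.card])
  have hi : ∀ x x', C.block x = C.block x' → (C.index x).2 = (C.index x').2 → x = x' :=
    fun x x' h1 h2 => C.index.injective (Prod.ext h1 h2)
  rintro ⟨r, x, y, z⟩ h ⟨r', x', y', z'⟩ h' e
  replace h := (Finset.mem_filter.1 (Finset.mem_coe.1 h)).2
  replace h' := (Finset.mem_filter.1 (Finset.mem_coe.1 h')).2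
  simp only [Prod.mk.injEq] at e ⊢
  obtain ⟨rfl, e1, e2⟩ := e
  rw [← h'] at h
  cases r <;>
    · have := C.machine.injective h
      simp only [Prod.mk.injEq] at this
      obtain ⟨h1, h2, h3⟩ := this
      first
      | exact ⟨rfl, hi _ _ h1 e1, hi _ _ h2 e2, h3⟩
      | exact ⟨rfl, hi _ _ h1 e1, hi _ _ h3 e2, h2⟩
      | exact ⟨rfl, hi _ _ h2 e1, hi _ _ h3 e2, h1⟩

end CubePartition

theorem card_filter_sumElim {M N V : Type} [Fintype M] [Fintype N] [DecidableEq V] (f : M → V)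
    (g : N → V) (v : V) :
    (Finset.univ.filter fun m => Sum.elim f g m = v).card =
      (Finset.univ.filter fun m => f m = v).card + (Finset.univ.filter fun m => g m = v).card := by
  simp only [Finset.card_filter, Fintype.sum_sum_type, Sum.elim_inl, Sum.elim_inr]
  rfl

/-- The contents of messages: an edge parameter, a label, a proposal, and a bit. -/
abbrev Payload (𝒜 W : Type) := Option W × Option 𝒜 × Option 𝒜 × Bool

/-- The messages: those of the left summand go from owners to workers, those of the right summand
go back. -/
abbrev ChainMessage (n k : ℕ) :=
  (Role × Fin n × Fin n × Fin k) ⊕ (Role × Fin n × Fin n × Fin k)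

/-- The local states in the simulation of the chains. -/
inductive ChainState (n k : ℕ) (𝒜 W : Type)
  | proposed (x : VertexInput n 𝒜 W) (σ : Fin n → Option 𝒜)
  | decided (x : VertexInput n 𝒜 W) (σ : Fin n → Option 𝒜) (y : ChainMessage n k → Payload 𝒜 W)
    (c : Fin n × Fin n × Fin n → Bool)
  | final (l : Fin n → 𝒜)

section Simulation

variable {n k s : ℕ} (C : CubePartition n k s) {𝒜 W : Type} [Fintype 𝒜]
  (F : Fin n → W → 𝒜 → 𝒜 → ℝ≥0)

/-- The acceptance probability of the edge between `t.1` and `t.2.1` in instance `t.2.2`, computed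
from the messages `y` that the machine in charge has received. -/
def localAcceptProb (y : ChainMessage n k → Payload 𝒜 W) (t : Fin n × Fin n × Fin n) : ℝ≥0 :=
  match (y (.inl (.edge, t.1, t.2.1, C.block t.2.2))).1,
      (y (.inl (.lower, t.1, t.2.2, C.block t.2.1))).2,
      (y (.inl (.upper, t.2.1, t.2.2, C.block t.1))).2 with
  | none, _, _ => 1
  | some w, (X, σ, _), (X', σ', _) =>
    acceptFactor (F t.2.2 w) X σ' * acceptFactor (F t.2.2 w) σ X' * acceptFactor (F t.2.2 w) σ σ'

theorem localAcceptProb_le_one (y : ChainMessage n k → Payload 𝒜 W)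
    (t : Fin n × Fin n × Fin n) : localAcceptProb C F y t ≤ 1 := by
  unfold localAcceptProb
  split
  · exact le_rfl
  · exact mul_le_one' (mul_le_one' (acceptFactor_le_one _ _ _) (acceptFactor_le_one _ _ _))
      (acceptFactor_le_one _ _ _)

open Classical in
/-- What the worker of a message reports to its owner: whether it has accepted all edges between
the owner and the block in question. -/
def verdict (y : ChainMessage n k → Payload 𝒜 W) (c : Fin n × Fin n × Fin n → Bool) :
    Role × Fin n × Fin n × Fin k → Bool
  | (.edge, _) => true
  | (.lower, u, i, z) => decide (∀ v, C.block v = z → u < v →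
      (y (.inl (.edge, u, v, C.block i))).1 ≠ none → c (u, v, i) = true)
  | (.upper, v, i, z) => decide (∀ u, C.block u = z → u < v →
      (y (.inl (.edge, u, v, C.block i))).1 ≠ none → c (u, v, i) = true)

/-- The contents of the messages sent from a given state. -/
def chainSend : ChainState n k 𝒜 W → ChainMessage n k → Payload 𝒜 W
  | .proposed x _, .inl (.edge, _, v, _) => (x.edge v, none, none, true)
  | .proposed x σ, .inl (_, _, i, _) => (none, some (x.label i), σ i, true)
  | .decided _ _ y c, .inr m => (none, none, none, verdict C y c m)
  | _, _ => default

/-- The label of `v` in instance `i` after the verdicts `y` of the workers. -/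
def newLabel (x : VertexInput n 𝒜 W) (σ : Fin n → Option 𝒜) (y : ChainMessage n k → Payload 𝒜 W)
    (v i : Fin n) : 𝒜 :=
  if ∀ z, (y (.inr (.lower, v, i, z))).2.2.2 = true ∧ (y (.inr (.upper, v, i, z))).2.2.2 = true
  then (σ i).getD (x.label i) else x.label i

/-- The simulation of one transition of all chains by messages between owners and workers. -/
abbrev chainAlgorithm (p : Fin n → ℝ≥0) (hp : ∀ i, p i ≤ 1) :
    RoutedAlgorithm n (ChainMessage n k) (Payload 𝒜 W) (VertexInput n 𝒜 W) (Fin n → 𝒜) where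
  src := Sum.elim CubePartition.owner C.worker
  dst := Sum.elim C.worker CubePartition.owner
  State := ChainState n k 𝒜 W
  init _ x := (x.propose p hp).map (.proposed x)
  send _ := chainSend C
  recv v s y :=
    match s with
    | .proposed x σ =>
      -- Each machine flips coins even for triples outside its charge, where `y` is meaningless. No
      -- verdict that is sent depends on those coins.
      (PMF.product fun t => coin (localAcceptProb C F y t) (localAcceptProb_le_one C F y t)).map
        (.decided x σ y)
    | .decided x σ _ _ => PMF.pure (.final (newLabel x σ y v))
    | .final l => PMF.pure (.final l)
  rounds := 2
  output _
    | .proposed x _ => x.label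
    | .decided x _ _ _ => x.label
    | .final l => l

variable (p : Fin n → ℝ≥0) (hp : ∀ i, p i ≤ 1) (x : Fin n → VertexInput n 𝒜 W)
  (σ : Fin n → Fin n → Option 𝒜)

/-- What each machine has received after the first round. -/
def firstReceived (v : Fin n) (m : ChainMessage n k) : Payload 𝒜 W :=
  (chainAlgorithm C F p hp).received (fun u => .proposed (x u) (σ u)) v m

/-- What each machine has received in the second round. -/
def secondReceived (c : Fin n → Fin n × Fin n × Fin n → Bool) (v : Fin n) (m : ChainMessage n k) :
    Payload 𝒜 W :=
  (chainAlgorithm C F p hp).received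
    (fun u => .decided (x u) (σ u) (firstReceived C F p hp x σ u) (c u)) v m

/-- All randomness lies in the initial proposals and in the coins of the first round; the second
round is deterministic. -/
theorem chainAlgorithm_run :
    (chainAlgorithm C F p hp).run x =
      (PMF.product fun v => (x v).propose p hp).bind fun σ =>
        (PMF.product fun w => PMF.product fun t =>
          coin (localAcceptProb C F (firstReceived C F p hp x σ w) t)
            (localAcceptProb_le_one C F _ t)).map
          fun c v => newLabel (x v) (σ v) (secondReceived C F p hp x σ c v) v := by
  have h0 : (PMF.product fun v => (chainAlgorithm C F p hp).init v (x v)) =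
      (PMF.product fun v => (x v).propose p hp).map fun σ v => .proposed (x v) (σ v) :=
    PMF.product_map _ _
  have h1 : ∀ σ : Fin n → Fin n → Option 𝒜,
      (chainAlgorithm C F p hp).round (fun v => .proposed (x v) (σ v)) =
        (PMF.product fun w => PMF.product fun t =>
          coin (localAcceptProb C F (firstReceived C F p hp x σ w) t)
            (localAcceptProb_le_one C F _ t)).map
          fun c v => .decided (x v) (σ v) (firstReceived C F p hp x σ v) (c v) :=
    fun σ => PMF.product_map _ _
  have h2 : ∀ (σ : Fin n → Fin n → Option 𝒜) (c : Fin n → Fin n × Fin n × Fin n → Bool),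
      (chainAlgorithm C F p hp).round
        (fun v => .decided (x v) (σ v) (firstReceived C F p hp x σ v) (c v)) =
        PMF.pure fun v => .final (newLabel (x v) (σ v) (secondReceived C F p hp x σ c v) v) :=
    fun σ c => PMF.product_pure _
  have h3 : (chainAlgorithm C F p hp).run x =
      (((PMF.product fun v => (chainAlgorithm C F p hp).init v (x v)).bind
        (chainAlgorithm C F p hp).round).bind (chainAlgorithm C F p hp).round).map
          fun s v => (chainAlgorithm C F p hp).output v (s v) := rfl
  rw [h3, h0, PMF.bind_map, PMF.bind_bind, PMF.map_bind]
  congr 1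
  funext σ
  rw [Function.comp_apply, h1, PMF.bind_map, PMF.map_bind, ← PMF.bind_pure_comp]
  congr 1
  funext c
  rw [Function.comp_apply, h2, PMF.pure_map]
  rfl

end Simulation

/-! ### Correctness of the simulation -/

theorem Sym2.mk_inf_sup {α : Type*} [LinearOrder α] (e : Sym2 α) : s(e.inf, e.sup) = e := by
  induction e with | h a b => ?_
  rcases le_total a b with h | h
  · simp [h]
  · simp [h, Sym2.eq_swap]

theorem vertexInput_edge_ne_none {n : ℕ} {𝒜 W : Type} (G : SimpleGraph (Fin n)) (θ : G.edgeSet → W)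
    (M : Fin n → PairwiseMRF G 𝒜) (X : Fin n → Fin n → 𝒜) (u v : Fin n) :
    (vertexInput G θ M X u).edge v ≠ none ↔ G.Adj u v := by
  simp [vertexInput]

theorem vertexInput_edge_inf_sup {n : ℕ} {𝒜 W : Type} (G : SimpleGraph (Fin n)) (θ : G.edgeSet → W)
    (M : Fin n → PairwiseMRF G 𝒜) (X : Fin n → Fin n → 𝒜) (e : G.edgeSet) :
    (vertexInput G θ M X e.1.inf).edge e.1.sup = some (θ e) := by
  obtain ⟨e, he⟩ := e
  have h : s(e.inf, e.sup) = e := Sym2.mk_inf_sup e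
  have h' : G.Adj e.inf e.sup := by rwa [← SimpleGraph.mem_edgeSet, h]
  simp only [vertexInput, dif_pos h', h]

section Correctness

variable {n k s : ℕ} (C : CubePartition n k s) {𝒜 W : Type} [Fintype 𝒜]
  (F : Fin n → W → 𝒜 → 𝒜 → ℝ≥0) (p : Fin n → ℝ≥0) (hp : ∀ i, p i ≤ 1)
  (σ : Fin n → Fin n → Option 𝒜) (c : Fin n → Fin n × Fin n × Fin n → Bool)

theorem firstReceived_edge (x : Fin n → VertexInput n 𝒜 W) (u v : Fin n) (z : Fin k) :
    firstReceived C F p hp x σ (C.machine (C.block u, C.block v, z)) (.inl (.edge, u, v, z)) =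
      ((x u).edge v, none, none, true) :=
  if_pos rfl

theorem firstReceived_lower (x : Fin n → VertexInput n 𝒜 W) (u i : Fin n) (z : Fin k) :
    firstReceived C F p hp x σ (C.machine (C.block u, z, C.block i)) (.inl (.lower, u, i, z)) =
      (none, some ((x u).label i), σ u i, true) :=
  if_pos rfl

theorem firstReceived_upper (x : Fin n → VertexInput n 𝒜 W) (v i : Fin n) (z : Fin k) :
    firstReceived C F p hp x σ (C.machine (z, C.block v, C.block i)) (.inl (.upper, v, i, z)) =
      (none, some ((x v).label i), σ v i, true) :=
  if_pos rfl

theorem secondReceived_inr (x : Fin n → VertexInput n 𝒜 W) (r : Role) (v i : Fin n) (z : Fin k) :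
    secondReceived C F p hp x σ c v (.inr (r, v, i, z)) =
      (none, none, none, verdict C (firstReceived C F p hp x σ (C.worker (r, v, i, z)))
        (c (C.worker (r, v, i, z))) (r, v, i, z)) :=
  if_pos rfl

/-- For `v` in block `z` the worker of this message is by definition the machine in charge of `(u,
v, i)`, so it holds both the edge report and the decisive coin. -/
theorem verdict_lower_eq_true (x : Fin n → VertexInput n 𝒜 W) (u i : Fin n) (z : Fin k) :
    verdict C (firstReceived C F p hp x σ (C.worker (.lower, u, i, z)))
        (c (C.worker (.lower, u, i, z))) (.lower, u, i, z) = true ↔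
      ∀ v, C.block v = z → u < v → (x u).edge v ≠ none →
        c (C.inCharge (u, v, i)) (u, v, i) = true := by
  simp only [verdict, decide_eq_true_eq]
  refine forall_congr' fun v => forall_congr' fun hv => ?_
  subst hv
  rw [show C.worker (.lower, u, i, C.block v) = C.machine (C.block u, C.block v, C.block i) from rfl,
    firstReceived_edge]
  rfl

theorem verdict_upper_eq_true (x : Fin n → VertexInput n 𝒜 W) (v i : Fin n) (z : Fin k) :
    verdict C (firstReceived C F p hp x σ (C.worker (.upper, v, i, z)))
        (c (C.worker (.upper, v, i, z))) (.upper, v, i, z) = true ↔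
      ∀ u, C.block u = z → u < v → (x u).edge v ≠ none →
        c (C.inCharge (u, v, i)) (u, v, i) = true := by
  simp only [verdict, decide_eq_true_eq]
  refine forall_congr' fun u => forall_congr' fun hu => ?_
  subst hu
  rw [show C.worker (.upper, v, i, C.block u) = C.machine (C.block u, C.block v, C.block i) from rfl,
    firstReceived_edge]
  rfl

variable (G : SimpleGraph (Fin n)) (θ : G.edgeSet → W) (M : Fin n → PairwiseMRF G 𝒜)
  (X : Fin n → Fin n → 𝒜)

/-- Every neighbour of `v` lies in exactly one block and is either larger or smaller than `v`. So
the lower and upper verdicts over all blocks together cover each incident edge. -/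
theorem newLabel_eq_update (v i : Fin n) :
    newLabel (vertexInput G θ M X v) (σ v)
        (secondReceived C F p hp (vertexInput G θ M X) σ c v) v i =
      PairwiseMRF.update (X i) (fun u => σ u i)
        (fun e : G.edgeSet => c (C.inCharge (e.1.inf, e.1.sup, i)) (e.1.inf, e.1.sup, i)) v := by
  classical
  unfold newLabel PairwiseMRF.update
  refine if_congr ?_ rfl rfl
  simp only [secondReceived_inr, verdict_lower_eq_true, verdict_upper_eq_true,
    vertexInput_edge_ne_none]
  constructor
  · rintro h ⟨e, he⟩ hv
    induction e with | h a b => ?_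
    have key : ∀ a b, a < b → G.Adj a b → (v = a ∨ v = b) →
        c (C.inCharge (a, b, i)) (a, b, i) = true := by
      rintro a b hab hG (rfl | rfl)
      · exact (h _).1 b rfl hab hG
      · exact (h _).2 a rfl hab hG
    have hG : G.Adj a b := he
    have hv' : v = a ∨ v = b := by simpa using hv
    rcases lt_or_gt_of_ne hG.ne with hab | hab
    · simpa [Sym2.inf_mk, Sym2.sup_mk, inf_eq_left.2 hab.le, sup_eq_right.2 hab.le] using
        key a b hab hG hv'
    · simpa [Sym2.inf_mk, Sym2.sup_mk, inf_eq_right.2 hab.le, sup_eq_left.2 hab.le] using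
        key b a hab hG.symm hv'.symm
  · intro h z
    have key : ∀ a b, a < b → G.Adj a b → (v = a ∨ v = b) →
        c (C.inCharge (a, b, i)) (a, b, i) = true := by
      intro a b hab hG hv
      simpa [Sym2.inf_mk, Sym2.sup_mk, inf_eq_left.2 hab.le, sup_eq_right.2 hab.le] using
        h ⟨s(a, b), hG⟩ (by simpa using hv)
    exact ⟨fun b _ hab hG => key v b hab hG (.inl rfl), fun a _ hab hG => key a v hab hG (.inr rfl)⟩

theorem localAcceptProb_eq (hF : ∀ i e, (M i).A e = F i (θ e)) (e : G.edgeSet) (i : Fin n) :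
    localAcceptProb C F (firstReceived C F p hp (vertexInput G θ M X) σ
        (C.inCharge (e.1.inf, e.1.sup, i))) (e.1.inf, e.1.sup, i) =
      (M i).acceptProb (X i) (fun u => σ u i) e := by
  unfold localAcceptProb CubePartition.inCharge
  simp only [firstReceived_edge, firstReceived_lower, firstReceived_upper,
    vertexInput_edge_inf_sup, PairwiseMRF.acceptProb, hF]
  rfl

theorem coin_congr {p q : ℝ≥0} (hp : p ≤ 1) (hq : q ≤ 1) (h : p = q) : coin p hp = coin q hq := by
  subst h
  rfl

theorem chainAlgorithm_run_eq (hF : ∀ i e, (M i).A e = F i (θ e)) :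
    (chainAlgorithm C F p hp).run (vertexInput G θ M X) =
      (PMF.product fun i => (M i).transition (p i) (hp i) (X i)).map
        (fun (Y : Fin n → Fin n → 𝒜) (v i : Fin n) => Y i v) := by
  classical
  rw [chainAlgorithm_run, PairwiseMRF.product_transition]
  simp only [VertexInput.propose_vertexInput]
  congr 1
  funext σ
  -- Distinct pairs of an instance and an edge use distinct coins: the triple alone recovers the
  -- instance and both endpoints.
  have hinj : Function.Injective fun x : Fin n × G.edgeSet =>
      (C.inCharge (x.2.1.inf, x.2.1.sup, x.1), (x.2.1.inf, x.2.1.sup, x.1)) := by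
    rintro ⟨i, e⟩ ⟨i', e'⟩ h
    simp only [Prod.mk.injEq] at h
    obtain ⟨-, h1, h2, rfl⟩ := h
    refine Prod.ext rfl (Subtype.ext ?_)
    rw [← Sym2.mk_inf_sup e.1, ← Sym2.mk_inf_sup e'.1, h1, h2]
  have h := PMF.product_product_marginal (fun w t =>
    coin (localAcceptProb C F (firstReceived C F p hp (vertexInput G θ M X) σ w) t)
      (localAcceptProb_le_one C F _ t)) _ _ hinj
  simp only [coin_congr _ ((M _).acceptProb_le_one _ _ _)
    (localAcceptProb_eq C F p hp σ G θ M X hF _ _)] at h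
  have h' : ∀ c : Fin n → Fin n × Fin n × Fin n → Bool,
      (fun v => newLabel (vertexInput G θ M X v) (σ v)
        (secondReceived C F p hp (vertexInput G θ M X) σ c v) v) =
      fun v i => PairwiseMRF.update (X i) (fun u => σ u i)
        (fun e : G.edgeSet => c (C.inCharge (e.1.inf, e.1.sup, i)) (e.1.inf, e.1.sup, i)) v :=
    fun c => funext fun v => funext fun i => newLabel_eq_update C F p hp σ c G θ M X v i
  refine (congrArg (fun f => PMF.map f _) (funext h')).trans ?_
  refine Eq.trans ?_ (congrArg (PMF.map _) h)
  rw [PMF.map_comp]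
  rfl

end Correctness

/-! ### The round complexity -/

theorem exists_cubePartition {n k : ℕ} (h1 : k ^ 3 ≤ n) (h2 : n ≤ 8 * k ^ 3) :
    Nonempty (CubePartition n k (8 * k ^ 2)) := by
  have hi : Nonempty (Fin n ↪ Fin k × Fin (8 * k ^ 2)) :=
    Function.Embedding.nonempty_of_card_le (by simp; linarith)
  have hm : Nonempty (Fin k × Fin k × Fin k ↪ Fin n) :=
    Function.Embedding.nonempty_of_card_le (by simp; linarith)
  exact ⟨hi.some, hm.some⟩

theorem Polynomial.exists_eval_le_two_pow_clog (P : Polynomial ℕ) :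
    ∃ c : ℕ, ∀ n, 2 ≤ n → P.eval n ≤ 2 ^ (c * Nat.clog 2 n) := by
  induction P using Polynomial.induction_on' with
  | add P Q hP hQ =>
    obtain ⟨c, hc⟩ := hP
    obtain ⟨d, hd⟩ := hQ
    refine ⟨c + d + 1, fun n hn => ?_⟩
    have h1 : 1 ≤ Nat.clog 2 n := Nat.clog_pos (by norm_num) hn
    have hc' := (hc n hn).trans (Nat.pow_le_pow_right two_pos
      (Nat.mul_le_mul_right (Nat.clog 2 n) (Nat.le_add_right c d)))
    have hd' := (hd n hn).trans (Nat.pow_le_pow_right two_pos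
      (Nat.mul_le_mul_right (Nat.clog 2 n) (Nat.le_add_left d c)))
    rw [Polynomial.eval_add]
    calc _ ≤ 2 ^ ((c + d) * Nat.clog 2 n) * 2 ^ 1 := by linarith
      _ ≤ _ := by
        rw [← pow_add]
        exact Nat.pow_le_pow_right two_pos (by linarith)
  | monomial d a =>
    -- The coefficient is absorbed by a < 2^a and `1 ≤ Nat.clog 2 n`, the power by `n ≤ 2 ^ Nat.clog
    -- 2 n`.
    refine ⟨a + d, fun n hn => ?_⟩
    have h1 : 1 ≤ Nat.clog 2 n := Nat.clog_pos (by norm_num) hn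
    have h2 : n ≤ 2 ^ Nat.clog 2 n := Nat.le_pow_clog (by norm_num) n
    rw [Polynomial.eval_monomial, add_mul, pow_add, mul_comm d, pow_mul _ _ d]
    refine Nat.mul_le_mul ?_ (Nat.pow_le_pow_left h2 d)
    exact Nat.lt_two_pow_self.le.trans (Nat.pow_le_pow_right two_pos (Nat.le_mul_of_pos_right a h1))

/-- Without edges, no communication is needed. -/
def silentAlgorithm {n : ℕ} (bits : ℕ) {𝒜 W : Type} [Fintype 𝒜] (p : Fin n → ℝ≥0)
    (hp : ∀ i, p i ≤ 1) : CliqueAlgorithm n bits (VertexInput n 𝒜 W) (Fin n → 𝒜) where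
  State := Fin n → 𝒜
  init _ x := (x.propose p hp).map fun σ i => (σ i).getD (x.label i)
  send _ _ _ := 0
  recv _ s _ := PMF.pure s
  rounds := 0
  output _ s := s

theorem silentAlgorithm_run {n : ℕ} (bits : ℕ) {𝒜 W : Type} [Fintype 𝒜] (p : Fin n → ℝ≥0)
    (hp : ∀ i, p i ≤ 1) (G : SimpleGraph (Fin n)) [IsEmpty G.edgeSet] (θ : G.edgeSet → W)
    (M : Fin n → PairwiseMRF G 𝒜) (X : Fin n → Fin n → 𝒜) :
    (silentAlgorithm bits p hp).run (vertexInput G θ M X) =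
      (PMF.product fun i => (M i).transition (p i) (hp i) (X i)).map
        (fun (Y : Fin n → Fin n → 𝒜) (v i : Fin n) => Y i v) := by
  rw [PairwiseMRF.product_transition]
  have h : (silentAlgorithm bits p hp).run (vertexInput G θ M X) =
      (PMF.product fun v => ((vertexInput G θ M X v).propose p hp).map
        fun σ i => (σ i).getD (X i v)).map id := rfl
  rw [h, PMF.map_id, PMF.product_map, ← PMF.bind_pure_comp]
  simp only [VertexInput.propose_vertexInput]
  congr 1
  funext σ
  have h' : ∀ acc : Fin n × G.edgeSet → Bool,
      (fun v i => PairwiseMRF.update (X i) (fun u => σ u i) (fun e => acc (i, e)) v) =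
        fun v i => (σ v i).getD (X i v) :=
    fun acc => funext fun v => funext fun i => if_pos fun e => isEmptyElim e
  exact (PMF.map_const _ _).symm.trans (congrArg (fun f => PMF.map f _) (funext h').symm)

end

theorem mainTheorem1 (P : Polynomial ℕ) :
    ∃ (c : ℕ) (C : ℝ), ∀ (n : ℕ) (𝒜 W : Type) [Fintype 𝒜] [Fintype W],
      Fintype.card 𝒜 ≤ P.eval n → Fintype.card W ≤ P.eval n →
      ∀ (p : Fin n → ℝ≥0) (hp : ∀ i, p i ≤ 1) (F : Fin n → W → 𝒜 → 𝒜 → ℝ≥0),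
        ∃ alg : CliqueAlgorithm n (c * Nat.clog 2 n) (VertexInput n 𝒜 W) (Fin n → 𝒜),
          (alg.rounds : ℝ) ≤ C * (n : ℝ) ^ (1 / 3 : ℝ) ∧
          ∀ (G : SimpleGraph (Fin n)) (θ : G.edgeSet → W) (M : Fin n → PairwiseMRF G 𝒜),
            (∀ i e, (M i).A e = F i (θ e)) →
            ∀ X : Fin n → Fin n → 𝒜,
              alg.run (vertexInput G θ M X) =
                (PMF.product fun i => (M i).transition (p i) (hp i) (X i)).map
                  (fun (Y : Fin n → Fin n → 𝒜) (v i : Fin n) => Y i v) := by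
  obtain ⟨c, hc⟩ := Polynomial.exists_eval_le_two_pow_clog
    -- This bounds the number of payloads: three optional entries and one bit.
    ((P + 1) * ((P + 1) * ((P + 1) * 2)))
  -- 1560 = 2 · 390 · 2: two routed rounds, each simulated in `2 * T` rounds with `T = 390 * k`, and
  -- `k ≤ r`.
  refine ⟨c, 1560, fun n 𝒜 W _ _ h𝒜 hW p hp F => ?_⟩
  -- For `n < 2` messages have zero bits, but there are no edges either. For `n = 0` the bound even
  -- forces zero rounds.
  rcases lt_or_ge n 2 with hn | hn
  · refine ⟨silentAlgorithm _ p hp, ?_, fun G θ M _ X => ?_⟩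
    · simp only [silentAlgorithm, Nat.cast_zero]
      positivity
    · have : Subsingleton (Fin n) := Fin.subsingleton_iff_le_one.2 (by omega)
      have : IsEmpty G.edgeSet := by
        refine ⟨fun ⟨e, he⟩ => ?_⟩
        induction e with | h a b => exact G.ne_of_adj he (Subsingleton.elim a b)
      exact silentAlgorithm_run _ p hp G θ M X
  · set r : ℝ := (n : ℝ) ^ (1 / 3 : ℝ) with hr
    have hr3 : r ^ 3 = n := by
      rw [hr, ← Real.rpow_natCast, ← Real.rpow_mul (by positivity)]
      norm_num
    have hr1 : 1 ≤ r := Real.one_le_rpow (by exact_mod_cast (by omega : 1 ≤ n)) (by norm_num)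
    set k := ⌊r⌋₊ with hk
    have hkr : (k : ℝ) ≤ r := Nat.floor_le (by linarith)
    have hk1 : 1 ≤ k := Nat.one_le_floor_iff _ |>.2 hr1
    have hrk : r ≤ 2 * k := by
      have h1 := Nat.lt_floor_add_one r
      have h2 : (1 : ℝ) ≤ k := by exact_mod_cast hk1
      rw [← hk] at h1
      linarith
    have h1 : k ^ 3 ≤ n := by
      have : (k : ℝ) ^ 3 ≤ n := hr3 ▸ pow_le_pow_left₀ (by positivity) hkr 3
      exact_mod_cast this
    have h2 : n ≤ 8 * k ^ 3 := by
      have : (n : ℝ) ≤ (2 * k) ^ 3 := hr3 ▸ pow_le_pow_left₀ (by linarith) hrk 3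
      rw [mul_pow] at this
      norm_num at this
      exact_mod_cast this
    obtain ⟨C⟩ := exists_cubePartition h1 h2
    -- The second term is 192k⁴, at most 192nk by `h1`. Then `T = 390 * k` is exactly what `2 * d ≤
    -- n * T` requires.
    have hd : 3 * (n * k) + 3 * ((8 * k ^ 2) * (8 * k ^ 2)) ≤ 195 * (n * k) := by
      have := Nat.mul_le_mul_right k h1
      nlinarith
    have hcard : Fintype.card (Payload 𝒜 W) ≤ 2 ^ (c * Nat.clog 2 n) := by
      refine le_trans ?_ (hc n hn)
      simp only [Fintype.card_prod, Fintype.card_option, Fintype.card_bool, Polynomial.eval_mul,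
        Polynomial.eval_add, Polynomial.eval_one, Polynomial.eval_ofNat]
      gcongr
    obtain ⟨alg, hrounds, hrun⟩ := (chainAlgorithm C F p hp).exists_cliqueAlgorithm
      (195 * (n * k)) (390 * k) (by omega) (by linarith) hcard
      (fun v => by
        rw [card_filter_sumElim]
        exact (add_le_add (CubePartition.card_owner_le v) (C.card_worker_le v)).trans hd)
      (fun v => by
        rw [card_filter_sumElim]
        exact (add_le_add (C.card_worker_le v) (CubePartition.card_owner_le v)).trans
          (by rwa [add_comm]))
    refine ⟨alg, ?_, fun G θ M hF X => (hrun _).trans (chainAlgorithm_run_eq C F p hp G θ M X hF)⟩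
    rw [hrounds]
    push_cast
    linarith
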